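/- Let $W:\mathbb R\to\mathbb R$ be a double-well potential, i.e. $W$ is continuous, there are $\alpha_W,\beta_W>0$ with $\alpha_W(1-|z|)^2\le W(z)\le \beta_W(1-|z|)^2$ for $|z|\le 2$, and $\inf_{|z|\ge 2}W(z)>0$. Let $k\in\mathbb N=\{0,1,2,\dots\}$ and $s\in(0,1)$ with $k+s>\tfrac12$. Let $a:\mathbb R^2\to\mathbb R$ be a homogenization kernel, i.e. $a$ is measurable, $1$-periodic in each variable, $\operatorname{ess\,inf}a>0$ and $\operatorname{ess\,sup}a<+\infty$. For a measurable function $b:\mathbb R^2\to\mathbb R$ with $\operatorname{ess\,inf}b>0$ and $\operatorname{ess\,sup}b<+\infty$, for $v\in H^{k+s}_{\rm loc}(\mathbb R)$ and for $\omega\in\{\pm1\}$ put $$\Phi^b(v)=\int_{\mathbb R}W(v(x))\,dx+\int_{\mathbb R}\int_{\mathbb R}b(x,y)\frac{|v^{(k)}(x)-v^{(k)}(y)|^2}{|x-y|^{1+2s}}\,dx\,dy\in[0,+\infty],$$ $$m^\omega(b)=\inf\Big\{\Phi^b(v):\ v\in H^{k+s}_{\rm loc}(\mathbb R),\ \lim_{x\to\pm\infty}v(x)=\pm\omega\Big\},\qquad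 m=m^{1}(1).$$ Then $m^\omega(a)>0$ for each $\omega\in\{\pm1\}$. Moreover, the limit energies are not trivial: for every $u\in BV((0,1);\{\pm1\})$ that is not almost everywhere constant, with jump set $S(u)$ and set $S^{\omega}(u)$ of ascending ($\omega=1$) or descending ($\omega=-1$) jumps, one has 1. $\displaystyle\sum_{\omega\in\{\pm1\}}m^\omega\big(a(\cdot/\lambda,\cdot/\lambda)\big)\,\#S^\omega(u)>0$ for every $\lambda\in(0,+\infty)$ (critical regime); 2. $\displaystyle\Big(\int_0^1\!\int_0^1a(x,y)\,dx\,dy\Big)^{\frac1{2(k+s)}}m\,\#S(u)>0$ (supercritical regime); 3. if $a$ is continuous, $\displaystyle\Big(\inf_{t\in(0,1)}a(t,t)\Big)^{\frac1{2(k+s)}}m\,\#S(u)>0$ (subcritical regime). -/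

import Mathlib

open MeasureTheory Set Filter Topology
open scoped ENNReal ContDiff

noncomputable section

/-- A (regular) double-well potential with wells at `-1` and `1`. -/
structure IsDoubleWell (W : ℝ → ℝ) : Prop where
  continuous : Continuous W
  quadratic : ∃ α β : ℝ, 0 < α ∧ 0 < β ∧
    ∀ z : ℝ, |z| ≤ 2 → α * (1 - |z|) ^ 2 ≤ W z ∧ W z ≤ β * (1 - |z|) ^ 2
  away : ∃ c : ℝ, 0 < c ∧ ∀ z : ℝ, 2 ≤ |z| → c ≤ W z

/-- A homogenization kernel: a Lebesgue measurable function on the plane, `1`-periodic in each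
variable, with positive essential infimum and finite essential supremum. -/
structure IsHomogenizationKernel (a : ℝ → ℝ → ℝ) : Prop where
  aemeasurable : AEMeasurable (fun p : ℝ × ℝ => a p.1 p.2) volume
  periodic_left : ∀ x y : ℝ, a (x + 1) y = a x y
  periodic_right : ∀ x y : ℝ, a x (y + 1) = a x y
  essInf_pos : ∃ α : ℝ, 0 < α ∧ ∀ᵐ p : ℝ × ℝ, α ≤ a p.1 p.2
  essSup_lt_top : ∃ β : ℝ, ∀ᵐ p : ℝ × ℝ, a p.1 p.2 ≤ β

/-- `w` is a `j`-th weak derivative of `v` on the real line. -/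
def IsWeakDeriv (j : ℕ) (v w : ℝ → ℝ) : Prop :=
  LocallyIntegrable v ∧ LocallyIntegrable w ∧
    ∀ φ : ℝ → ℝ, ContDiff ℝ ∞ φ → HasCompactSupport φ →
      ∫ x, v x * iteratedDeriv j φ x = (-1) ^ j * ∫ x, w x * φ x

open Classical in
/-- The `j`-th weak derivative `v^(j)` (a representative of it, which is unique up to null sets);
the value `0` is used when there is none. -/
def weakDeriv (j : ℕ) (v : ℝ → ℝ) : ℝ → ℝ :=
  if h : ∃ w, IsWeakDeriv j v w then h.choose else 0

/-- The weighted squared Gagliardo seminorm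
`∫_I ∫_I a(x,y) |w(x) - w(y)|² / |x - y|^(1+2s) dx dy`, with values in `[0,∞]`. -/
def gagliardoEnergy (s : ℝ) (a : ℝ → ℝ → ℝ) (w : ℝ → ℝ) (I : Set ℝ) : ℝ≥0∞ :=
  ∫⁻ p in I ×ˢ I,
    ENNReal.ofReal (a p.1 p.2 * (|w p.1 - w p.2| ^ 2 / |p.1 - p.2| ^ (1 + 2 * s)))

/-- `v ∈ H^{k+s}_loc(ℝ)`: the weak derivatives of `v` of order `0, …, k` exist and are square
integrable on bounded intervals, on which `v^(k)` has finite Gagliardo seminorm. -/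
def MemHloc (k : ℕ) (s : ℝ) (v : ℝ → ℝ) : Prop :=
  (∀ j ≤ k, (∃ w, IsWeakDeriv j v w) ∧
    ∀ b c : ℝ, MemLp (weakDeriv j v) 2 (volume.restrict (Ioo b c))) ∧
  ∀ b c : ℝ, gagliardoEnergy s (fun _ _ => 1) (weakDeriv k v) (Ioo b c) < ⊤

/-- The rescaled functional `Φ^a(v, I)`, with values in `[0,∞]`. -/
def rescaledEnergy (W : ℝ → ℝ) (k : ℕ) (s : ℝ) (a : ℝ → ℝ → ℝ) (v : ℝ → ℝ) (I : Set ℝ) : ℝ≥0∞ :=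
  (∫⁻ x in I, ENNReal.ofReal (W (v x))) + gagliardoEnergy s a (weakDeriv k v) I

/-- The transition energy `m^σ(a)` (for `σ = 1` or `σ = -1`): the infimum of `Φ^a(v, ℝ)` over all
`v ∈ H^{k+s}_loc(ℝ)` that tend to `σ` at `+∞` and to `-σ` at `-∞`. -/
def transitionEnergy (W : ℝ → ℝ) (k : ℕ) (s : ℝ) (σ : ℝ) (a : ℝ → ℝ → ℝ) : ℝ≥0∞ :=
  sInf {E : ℝ≥0∞ | ∃ v : ℝ → ℝ, MemHloc k s v ∧ Tendsto v atTop (𝓝 σ) ∧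
    Tendsto v atBot (𝓝 (-σ)) ∧ E = rescaledEnergy W k s a v univ}

/-- `u ∈ BV((0,1); {±1})`: `u` takes the values `±1` almost everywhere in `(0,1)` and agrees
almost everywhere there with a function of bounded pointwise variation. -/
def IsSignBV (u : ℝ → ℝ) : Prop :=
  (∀ᵐ x ∂(volume.restrict (Ioo (0 : ℝ) 1)), u x = 1 ∨ u x = -1) ∧
    ∃ v : ℝ → ℝ, BoundedVariationOn v (Ioo 0 1) ∧
      ∀ᵐ x ∂(volume.restrict (Ioo (0 : ℝ) 1)), u x = v x

/-- The essential one-sided limits of `u` at `t` are `l` (from the left) and `r` (from the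
right). -/
def HasOneSidedLimits (u : ℝ → ℝ) (t l r : ℝ) : Prop :=
  Tendsto u (𝓝[<] t ⊓ ae volume) (𝓝 l) ∧ Tendsto u (𝓝[>] t ⊓ ae volume) (𝓝 r)

/-- The jump set `S(u)` of `u` in `(0,1)`. -/
def jumpSet (u : ℝ → ℝ) : Set ℝ :=
  {t | t ∈ Ioo (0 : ℝ) 1 ∧ ∃ l r : ℝ, HasOneSidedLimits u t l r ∧ l ≠ r}

/-- The set `S^σ(u)` of the ascending (`σ = 1`) or descending (`σ = -1`) jumps of `u`
in `(0,1)`. -/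
def directedJumpSet (σ : ℝ) (u : ℝ → ℝ) : Set ℝ :=
  {t | t ∈ Ioo (0 : ℝ) 1 ∧ ∃ l r : ℝ, HasOneSidedLimits u t l r ∧ Real.sign (r - l) = σ}

/-- The limit energy in the critical regime `δ/ε → l ∈ (0,∞)`. -/
def criticalLimitEnergy (W : ℝ → ℝ) (k : ℕ) (s : ℝ) (a : ℝ → ℝ → ℝ) (l : ℝ) (u : ℝ → ℝ) : ℝ≥0∞ :=
  transitionEnergy W k s 1 (fun x y => a (x / l) (y / l)) * (directedJumpSet 1 u).encard +
    transitionEnergy W k s (-1) (fun x y => a (x / l) (y / l)) * (directedJumpSet (-1) u).encard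

/-- The limit energy in the supercritical regime `δ/ε → 0`, with the average of `a`. -/
def supercriticalLimitEnergy (W : ℝ → ℝ) (k : ℕ) (s : ℝ) (a : ℝ → ℝ → ℝ) (u : ℝ → ℝ) : ℝ≥0∞ :=
  ENNReal.ofReal
      ((∫ p in Ioo (0 : ℝ) 1 ×ˢ Ioo (0 : ℝ) 1, a p.1 p.2) ^ (1 / (2 * ((k : ℝ) + s)))) *
    transitionEnergy W k s 1 (fun _ _ => 1) * (jumpSet u).encard

/-- The limit energy in the subcritical regime `δ/ε → +∞`, with the infimum of `a` on the
diagonal. -/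
def subcriticalLimitEnergy (W : ℝ → ℝ) (k : ℕ) (s : ℝ) (a : ℝ → ℝ → ℝ) (u : ℝ → ℝ) : ℝ≥0∞ :=
  ENNReal.ofReal (sInf ((fun t => a t t) '' Ioo (0 : ℝ) 1) ^ (1 / (2 * ((k : ℝ) + s)))) *
    transitionEnergy W k s 1 (fun _ _ => 1) * (jumpSet u).encard

end

/-!
The heart of the matter is that a transition between the wells `-1` and `1` has a definite cost.
Let `v` be an admissible profile, `w` its weak derivative of order `k`, and suppose that both the
Gagliardo seminorm of `w` and the measure of the set where `|v|` is not close to `1` are tiny.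

The seminorm controls the mean oscillation of `w` on every interval
(`hasOscBound_of_gagliardoEnergy_le`), and this control survives mollification
(`HasOscBound.mollify`), so `v` may be replaced by a smooth function `f` whose classical
derivative of order `k` has the same oscillation bound. The function `f` has opposite signs near
`±∞`, hence a zero `x`. The forward differences `Δ_r^{k+1} f x` are small on average over
`0 < r ≤ 1` (`exists_lintegral_fwdDiff_le`): for `k ≥ 1` because they are integrals of
differences of `f^(k)`, and for `k = 0`, where `s > 1/2`, by Campanato's dyadic argument. On the
other hand, for most `r` the values `f (x + j r)`, `1 ≤ j ≤ k + 1`, are close to `±1`. Since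
`f x = 0`, the difference `Δ_r^{k+1} f x` is then close to a combination of signs with
coefficients `± (k+1 choose j)`, `1 ≤ j ≤ k + 1`. It is an integer of the parity of
`2^(k+1) - 1`, so it is odd and not zero (`half_le_abs_fwdDiff_iter`). This contradiction is
`exists_transition_obstruction`, and it gives positive transition energies for all kernels that
are bounded below by a positive constant (`transitionEnergy_pos`).

The limit energies are positive because a function of bounded variation with values `±1` that is
not almost everywhere constant has a jump (`IsSignBV.exists_jump`), and because the prefactors
built from the kernel inherit its positive lower bound.
-/

/-! ### Mollification of weak derivatives -/

lemma hasCompactSupport_iteratedDeriv {ψ : ℝ → ℝ} (hc : HasCompactSupport ψ) (n : ℕ) :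
    HasCompactSupport (iteratedDeriv n ψ) := by
  induction n with
  | zero => simpa using hc
  | succ n ih => rw [iteratedDeriv_succ]; exact ih.deriv

lemma contDiff_iteratedDeriv {ψ : ℝ → ℝ} (hψ : ContDiff ℝ ∞ ψ) (n : ℕ) :
    ContDiff ℝ ∞ (iteratedDeriv n ψ) := by
  induction n with
  | zero => simpa using hψ
  | succ n ih => rw [iteratedDeriv_succ]; exact (contDiff_infty_iff_deriv.1 ih).2

lemma iteratedDeriv_convolution_left {ψ v : ℝ → ℝ} (hψ : ContDiff ℝ ∞ ψ)
    (hc : HasCompactSupport ψ) (hv : LocallyIntegrable v) (n : ℕ) :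
    iteratedDeriv n (convolution ψ v (ContinuousLinearMap.lsmul ℝ ℝ) volume) =
      convolution (iteratedDeriv n ψ) v (ContinuousLinearMap.lsmul ℝ ℝ) volume := by
  induction n with
  | zero => simp
  | succ n ih =>
    rw [iteratedDeriv_succ, ih, iteratedDeriv_succ]
    funext x
    exact ((hasCompactSupport_iteratedDeriv hc n).hasDerivAt_convolution_left _
      ((contDiff_iteratedDeriv hψ n).of_le (by exact_mod_cast le_top)) hv x).deriv

/-- Mollification turns a weak derivative into a classical one. -/
lemma IsWeakDeriv.iteratedDeriv_convolution {k : ℕ} {ψ v w : ℝ → ℝ} (h : IsWeakDeriv k v w)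
    (hψ : ContDiff ℝ ∞ ψ) (hc : HasCompactSupport ψ) :
    iteratedDeriv k (convolution ψ v (ContinuousLinearMap.lsmul ℝ ℝ) volume) =
      convolution ψ w (ContinuousLinearMap.lsmul ℝ ℝ) volume := by
  rw [iteratedDeriv_convolution_left hψ hc h.1]
  funext x
  have hsm : ContDiff ℝ ∞ (fun t => ψ (x - t)) := hψ.comp (contDiff_const.sub contDiff_id)
  have hcs : HasCompactSupport (fun t => ψ (x - t)) :=
    hc.comp_homeomorph (Homeomorph.subLeft x)
  have key := h.2.2 _ hsm hcs
  rw [iteratedDeriv_comp_const_sub] at key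
  rw [convolution_eq_swap, convolution_eq_swap]
  simp only [ContinuousLinearMap.lsmul_apply, smul_eq_mul] at key ⊢
  have e1 : ∫ t, v t * ((-1) ^ k * iteratedDeriv k ψ (x - t)) =
      (-1) ^ k * ∫ t, iteratedDeriv k ψ (x - t) * v t := by
    rw [← integral_const_mul]; congr 1; funext t; ring
  rw [e1] at key
  have := mul_left_cancel₀ (pow_ne_zero k (by norm_num : (-1 : ℝ) ≠ 0)) key
  rw [this]; congr 1; funext t; ring

/-! ### Mean oscillation on intervals -/

/-- A Campanato-type condition: the mean oscillation of `g` on an interval of length `L` is at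
most `M * L ^ (s - 1 / 2)`. It is stated without division, as a bound for the double integral of
`|g x - g y|` over the square of the interval. -/
def HasOscBound (s M : ℝ) (g : ℝ → ℝ) : Prop :=
  ∀ c L : ℝ, 0 < L → ∫⁻ x in Ioc c (c + L), ∫⁻ y in Ioc c (c + L), ‖g x - g y‖ₑ ≤
    ENNReal.ofReal (M * L ^ (s + 3 / 2))

/-- The Gagliardo seminorm controls mean oscillations, by the inequality of arithmetic and
geometric means with weights adapted to the length of the interval. -/
lemma hasOscBound_of_gagliardoEnergy_le {s M : ℝ} (hs : 0 < s) (hM : 0 < M) {w : ℝ → ℝ}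
    (hw : Measurable w)
    (h : gagliardoEnergy s (fun _ _ => 1) w univ ≤ ENNReal.ofReal (M ^ 2)) :
    HasOscBound s M w := by
  intro c L hL
  set I := Ioc c (c + L)
  set P := L ^ (s + 3 / 2) with hP
  have hPpos : 0 < P := Real.rpow_pos_of_pos hL _
  have hPsq : L ^ (1 + 2 * s) * L ^ 2 = P ^ 2 := by
    rw [hP, ← Real.rpow_natCast (L ^ (s + 3 / 2)), ← Real.rpow_mul hL.le, ← Real.rpow_natCast L,
      ← Real.rpow_add hL]
    congr 1; push_cast; ring
  set q : ℝ → ℝ → ℝ := fun x y => 1 * (|w x - w y| ^ 2 / |x - y| ^ (1 + 2 * s)) with hq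
  have hq0 : ∀ x y, 0 ≤ q x y := fun x y => by simp only [hq]; positivity
  have hqm : Measurable (fun p : ℝ × ℝ => ENNReal.ofReal (q p.1 p.2)) := by
    simp only [hq]; fun_prop
  have hle : ∫⁻ x in I, ∫⁻ y in I, ENNReal.ofReal (q x y) ≤ ENNReal.ofReal (M ^ 2) := by
    refine le_trans ?_ h
    unfold gagliardoEnergy
    rw [univ_prod_univ, Measure.restrict_univ, Measure.volume_eq_prod,
      lintegral_prod _ hqm.aemeasurable]
    exact (lintegral_mono fun x => setLIntegral_le_lintegral _ _).trans
      (setLIntegral_le_lintegral _ _)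
  have hpt : ∀ x ∈ I, ∀ y ∈ I, ‖w x - w y‖ₑ ≤ ENNReal.ofReal (P / (2 * M)) *
      ENNReal.ofReal (q x y) + ENNReal.ofReal (M / (2 * P) * L ^ (1 + 2 * s)) := by
    intro x hx y hy
    rw [← ENNReal.ofReal_mul (by positivity), ← ENNReal.ofReal_add
      (mul_nonneg (by positivity) (hq0 x y)) (by positivity), ← ofReal_norm]
    apply ENNReal.ofReal_le_ofReal
    rw [Real.norm_eq_abs]
    rcases eq_or_ne x y with rfl | hxy
    · simp only [sub_self, abs_zero]
      have := hq0 x x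
      positivity
    · have hd : 0 < |x - y| := abs_pos.2 (sub_ne_zero.2 hxy)
      have hdL : |x - y| ≤ L := by
        rw [abs_le]; constructor <;> linarith [hx.1, hx.2, hy.1, hy.2]
      have hK : 0 < |x - y| ^ (1 + 2 * s) := Real.rpow_pos_of_pos hd _
      have hKL : |x - y| ^ (1 + 2 * s) ≤ L ^ (1 + 2 * s) :=
        Real.rpow_le_rpow hd.le hdL (by linarith)
      set K := |x - y| ^ (1 + 2 * s)
      set d := |w x - w y|
      have h1 : M / (2 * P) * K ≤ M / (2 * P) * L ^ (1 + 2 * s) := by gcongr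
      have h2 : d ≤ P / (2 * M) * (1 * (d ^ 2 / K)) + M / (2 * P) * K := by
        have : P / (2 * M) * (1 * (d ^ 2 / K)) + M / (2 * P) * K - d =
            (P * d - M * K) ^ 2 / (2 * M * P * K) := by
          field_simp
          ring
        have h3 : 0 ≤ (P * d - M * K) ^ 2 / (2 * M * P * K) := by positivity
        linarith
      linarith
  calc ∫⁻ x in I, ∫⁻ y in I, ‖w x - w y‖ₑ
      ≤ ∫⁻ x in I, ∫⁻ y in I, (ENNReal.ofReal (P / (2 * M)) *
      ENNReal.ofReal (q x y) + ENNReal.ofReal (M / (2 * P) * L ^ (1 + 2 * s))) := by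
        refine setLIntegral_mono' measurableSet_Ioc fun x hx => ?_
        exact setLIntegral_mono' measurableSet_Ioc fun y hy => hpt x hx y hy
    _ = ENNReal.ofReal (P / (2 * M)) * (∫⁻ x in I, ∫⁻ y in I, ENNReal.ofReal (q x y)) +
        ENNReal.ofReal (M / (2 * P) * L ^ (1 + 2 * s)) * ENNReal.ofReal L * ENNReal.ofReal L := by
        have hqx : ∀ x, Measurable fun y => ENNReal.ofReal (q x y) := fun x => by
          simp only [hq]; fun_prop
        have : ∀ x, ∫⁻ y in I, (ENNReal.ofReal (P / (2 * M)) *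
            ENNReal.ofReal (q x y) + ENNReal.ofReal (M / (2 * P) * L ^ (1 + 2 * s))) =
            ENNReal.ofReal (P / (2 * M)) * (∫⁻ y in I, ENNReal.ofReal (q x y)) +
            ENNReal.ofReal (M / (2 * P) * L ^ (1 + 2 * s)) * ENNReal.ofReal L := by
          intro x
          rw [lintegral_add_right _ measurable_const, lintegral_const_mul _ (hqx x),
            setLIntegral_const, Real.volume_Ioc, add_sub_cancel_left]
        have hqi : Measurable fun x => ∫⁻ y in I, ENNReal.ofReal (q x y) :=
          Measurable.lintegral_prod_right' (f := fun p : ℝ × ℝ => ENNReal.ofReal (q p.1 p.2)) hqm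
        simp_rw [this]
        rw [lintegral_add_right _ measurable_const, lintegral_const_mul _
          hqi, setLIntegral_const, Real.volume_Ioc,
          add_sub_cancel_left]
    _ ≤ ENNReal.ofReal (P / (2 * M)) * ENNReal.ofReal (M ^ 2) +
        ENNReal.ofReal (M / (2 * P) * L ^ (1 + 2 * s)) * ENNReal.ofReal L * ENNReal.ofReal L := by
        refine add_le_add ?_ le_rfl
        gcongr
    _ = ENNReal.ofReal (M * P) := by
        rw [← ENNReal.ofReal_mul (by positivity), ← ENNReal.ofReal_mul (by positivity),
          ← ENNReal.ofReal_mul (by positivity), ← ENNReal.ofReal_add (by positivity)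
          (by positivity)]
        congr 1
        have : M / (2 * P) * L ^ (1 + 2 * s) * L * L = M / (2 * P) * P ^ 2 := by
          rw [← hPsq]; ring
        rw [this]; field_simp; ring

/-- Averaging translates does not increase mean oscillations. -/
lemma HasOscBound.mollify {s M : ℝ} {w ψ : ℝ → ℝ} (hw : Measurable w)
    (hwl : LocallyIntegrable w) (hψ : Continuous ψ) (hc : HasCompactSupport ψ)
    (hψ1 : ∫⁻ z, ‖ψ z‖ₑ = 1) (h : HasOscBound s M w) :
    HasOscBound s M (convolution ψ w (ContinuousLinearMap.lsmul ℝ ℝ) volume) := by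
  intro c L hL
  set I := Ioc c (c + L)
  have hpt : ∀ x y, ‖convolution ψ w (ContinuousLinearMap.lsmul ℝ ℝ) volume x -
      convolution ψ w (ContinuousLinearMap.lsmul ℝ ℝ) volume y‖ₑ ≤
      ∫⁻ z, ‖ψ z‖ₑ * ‖w (x - z) - w (y - z)‖ₑ := by
    intro x y
    have hi := fun x => hc.convolutionExists_left (ContinuousLinearMap.lsmul ℝ ℝ) hψ hwl x
    have e : convolution ψ w (ContinuousLinearMap.lsmul ℝ ℝ) volume x -
      convolution ψ w (ContinuousLinearMap.lsmul ℝ ℝ) volume y =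
      ∫ z, ψ z * (w (x - z) - w (y - z)) := by
      unfold MeasureTheory.convolution
      rw [← integral_sub (hi x) (hi y)]
      simp only [ContinuousLinearMap.lsmul_apply, smul_eq_mul, mul_sub]
    rw [e]
    refine (enorm_integral_le_lintegral_enorm _).trans (le_of_eq ?_)
    simp only [enorm_mul]
  have hψm := hψ.measurable
  have htr : ∀ (F : ℝ → ℝ≥0∞) (z : ℝ),
      ∫⁻ x in I, F (x - z) = ∫⁻ x in Ioc (c - z) (c - z + L), F x := by
    intro F z
    have e : I = (fun x => x - z) ⁻¹' (Ioc (c - z) (c - z + L)) := by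
      ext x; simp only [I, mem_Ioc, mem_preimage]; constructor <;> rintro ⟨h1, h2⟩ <;>
        constructor <;> linarith
    rw [e]
    exact (measurePreserving_sub_right volume z).setLIntegral_comp_preimage_emb
      (measurableEmbedding_subRight z) F _
  calc ∫⁻ x in I, ∫⁻ y in I, ‖convolution ψ w (ContinuousLinearMap.lsmul ℝ ℝ) volume x -
      convolution ψ w (ContinuousLinearMap.lsmul ℝ ℝ) volume y‖ₑ
      ≤ ∫⁻ x in I, ∫⁻ y in I, ∫⁻ z, ‖ψ z‖ₑ * ‖w (x - z) - w (y - z)‖ₑ :=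
        lintegral_mono fun x => lintegral_mono fun y => hpt x y
    _ = ∫⁻ x in I, ∫⁻ z, ∫⁻ y in I, ‖ψ z‖ₑ * ‖w (x - z) - w (y - z)‖ₑ := by
        refine lintegral_congr fun x => ?_
        refine lintegral_lintegral_swap (Measurable.aemeasurable ?_)
        fun_prop
    _ = ∫⁻ z, ∫⁻ x in I, ∫⁻ y in I, ‖ψ z‖ₑ * ‖w (x - z) - w (y - z)‖ₑ := by
        refine lintegral_lintegral_swap (Measurable.aemeasurable ?_)
        refine Measurable.lintegral_prod_right' (f := fun p : (ℝ × ℝ) × ℝ =>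
          ‖ψ p.1.2‖ₑ * ‖w (p.1.1 - p.1.2) - w (p.2 - p.1.2)‖ₑ) ?_
        fun_prop
    _ = ∫⁻ z, ‖ψ z‖ₑ * ∫⁻ x in I, ∫⁻ y in I, ‖w (x - z) - w (y - z)‖ₑ := by
        refine lintegral_congr fun z => ?_
        rw [← lintegral_const_mul' _ _ (by simp)]
        refine lintegral_congr fun x => ?_
        rw [← lintegral_const_mul' _ _ (by simp)]
    _ ≤ ∫⁻ z, ‖ψ z‖ₑ * ENNReal.ofReal (M * L ^ (s + 3 / 2)) := by
        refine lintegral_mono fun z => ?_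
        gcongr
        refine le_trans (le_of_eq ?_) (h (c - z) L hL)
        rw [htr (fun x => ∫⁻ y in I, ‖w x - w (y - z)‖ₑ) z]
        refine lintegral_congr fun x => ?_
        exact htr (fun y => ‖w x - w y‖ₑ) z
    _ = ENNReal.ofReal (M * L ^ (s + 3 / 2)) := by
        rw [lintegral_mul_const' _ _ ENNReal.ofReal_ne_top, hψ1, one_mul]

/-! ### Forward differences -/

lemma contDiff_fwdDiff_iter {F : ℝ → ℝ} (hF : ContDiff ℝ ∞ F) (h : ℝ) (n : ℕ) :
    ContDiff ℝ ∞ ((fwdDiff h)^[n] F) := by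
  induction n generalizing F with
  | zero => exact hF
  | succ n ih =>
    rw [Function.iterate_succ_apply]
    exact ih ((hF.comp (contDiff_id.add contDiff_const)).sub hF)

lemma iteratedDeriv_fwdDiff {F : ℝ → ℝ} (hF : ContDiff ℝ ∞ F) (h : ℝ) (n : ℕ) :
    iteratedDeriv n (fwdDiff h F) = fwdDiff h (iteratedDeriv n F) := by
  funext x
  have hn : ContDiff ℝ n F := hF.of_le (by exact_mod_cast le_top)
  have hshift : ContDiff ℝ n (fun z => F (z + h)) := hn.comp (contDiff_id.add contDiff_const)
  have : fwdDiff h F = (fun z => F (z + h)) - F := rfl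
  rw [this, iteratedDeriv_sub hshift.contDiffAt hn.contDiffAt,
    iteratedDeriv_comp_add_const]
  rfl

lemma deriv_fwdDiff_iter {F : ℝ → ℝ} (hF : ContDiff ℝ ∞ F) (h : ℝ) (n : ℕ) :
    deriv ((fwdDiff h)^[n] F) = (fwdDiff h)^[n] (deriv F) := by
  induction n generalizing F with
  | zero => rfl
  | succ n ih =>
    rw [Function.iterate_succ_apply, Function.iterate_succ_apply,
      ih (F := fwdDiff h F) (contDiff_fwdDiff_iter hF h 1), ← iteratedDeriv_one,
      iteratedDeriv_fwdDiff hF, iteratedDeriv_one]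

lemma enorm_sub_le_lintegral_deriv {F : ℝ → ℝ} (hF : ContDiff ℝ ∞ F) {h : ℝ} (h0 : 0 ≤ h)
    (x : ℝ) : ‖F (x + h) - F x‖ₑ ≤ ∫⁻ t in Ioc x (x + h), ‖deriv F t‖ₑ := by
  rw [← intervalIntegral.integral_deriv_eq_sub
    (fun y _ => (hF.differentiable (by simp)).differentiableAt)
    ((hF.continuous_deriv (by simp)).intervalIntegrable _ _),
    intervalIntegral.integral_of_le (by linarith)]
  exact enorm_integral_le_lintegral_enorm _

/-- A forward difference of order `n + 1` with step at most `1` is controlled by the integral of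
the derivative of the same order. -/
lemma enorm_fwdDiff_iter_le {F : ℝ → ℝ} (hF : ContDiff ℝ ∞ F) {h : ℝ} (h0 : 0 ≤ h) (h1 : h ≤ 1)
    (n : ℕ) (x : ℝ) : ‖(fwdDiff h)^[n + 1] F x‖ₑ ≤
      ∫⁻ t in Ioc x (x + (n + 1)), ‖iteratedDeriv (n + 1) F t‖ₑ := by
  induction n generalizing F x with
  | zero =>
    simp only [zero_add, Function.iterate_one, iteratedDeriv_one, Nat.cast_zero]
    refine (enorm_sub_le_lintegral_deriv hF h0 x).trans (lintegral_mono_set ?_)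
    exact Ioc_subset_Ioc_right (by linarith)
  | succ n ih =>
    rw [Function.iterate_succ_apply']
    refine (enorm_sub_le_lintegral_deriv (contDiff_fwdDiff_iter hF h (n + 1)) h0 x).trans ?_
    rw [deriv_fwdDiff_iter hF]
    have hF' : ContDiff ℝ ∞ (deriv F) := (contDiff_infty_iff_deriv.1 hF).2
    calc ∫⁻ t in Ioc x (x + h), ‖(fwdDiff h)^[n + 1] (deriv F) t‖ₑ
        ≤ ∫⁻ _t in Ioc x (x + h), ∫⁻ t in Ioc x (x + (↑(n + 1) + 1)),
            ‖iteratedDeriv (n + 1 + 1) F t‖ₑ := by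
          refine setLIntegral_mono' measurableSet_Ioc fun t ht => (ih hF' t).trans ?_
          rw [← iteratedDeriv_succ']
          refine lintegral_mono_set (Ioc_subset_Ioc ht.1.le ?_)
          push_cast; linarith [ht.2]
      _ ≤ _ := by
          rw [setLIntegral_const, Real.volume_Ioc, add_sub_cancel_left]
          exact mul_le_of_le_one_right' (by simpa using h1)

/-- If `f^(k)` has controlled mean oscillation, `k ≥ 1`, then the forward differences of order
`k + 1` of `f` at a given point are small on average over the step. -/
lemma lintegral_fwdDiff_le_of_succ {f : ℝ → ℝ} (hf : ContDiff ℝ ∞ f) {s M : ℝ} (k : ℕ)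
    (h : HasOscBound s M (iteratedDeriv (k + 1) f)) (x : ℝ) :
    ∫⁻ r in Ioc (0 : ℝ) 1, ‖(fwdDiff r)^[k + 1 + 1] f x‖ₑ ≤
      ENNReal.ofReal (M * ((k : ℝ) + 2) ^ (s + 3 / 2)) := by
  set g := iteratedDeriv (k + 1) f
  have hg : Continuous g := (contDiff_iteratedDeriv hf (k + 1)).continuous
  calc ∫⁻ r in Ioc (0 : ℝ) 1, ‖(fwdDiff r)^[k + 1 + 1] f x‖ₑ
      ≤ ∫⁻ r in Ioc (0 : ℝ) 1, ∫⁻ t in Ioc x (x + (k + 1)), ‖g (t + r) - g t‖ₑ := by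
        refine setLIntegral_mono' measurableSet_Ioc fun r hr => ?_
        rw [Function.iterate_succ_apply]
        refine (enorm_fwdDiff_iter_le ((hf.comp (contDiff_id.add contDiff_const)).sub hf)
          hr.1.le hr.2 k x).trans (le_of_eq ?_)
        have := iteratedDeriv_fwdDiff hf r (k + 1)
        refine lintegral_congr fun t => ?_
        exact congrArg (fun G : ℝ → ℝ => ‖G t‖ₑ) this
    _ = ∫⁻ t in Ioc x (x + (k + 1)), ∫⁻ r in Ioc (0 : ℝ) 1, ‖g (t + r) - g t‖ₑ := by
        refine lintegral_lintegral_swap (Measurable.aemeasurable ?_)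
        have := hg.measurable
        fun_prop
    _ ≤ ∫⁻ t in Ioc x (x + (k + 1)), ∫⁻ y in Ioc x (x + (k + 2)), ‖g t - g y‖ₑ := by
        refine setLIntegral_mono' measurableSet_Ioc fun t ht => ?_
        have e : Ioc (0 : ℝ) 1 = (fun r => t + r) ⁻¹' Ioc t (t + 1) := by
          ext r; simp only [mem_Ioc, mem_preimage]; constructor <;> rintro ⟨h1, h2⟩ <;>
            constructor <;> linarith
        rw [e, (measurePreserving_add_left volume t).setLIntegral_comp_preimage_emb
          (measurableEmbedding_addLeft t) (fun y => ‖g y - g t‖ₑ) (Ioc t (t + 1))]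
        simp_rw [enorm_sub_rev (g t)]
        exact lintegral_mono_set (Ioc_subset_Ioc ht.1.le (by linarith [ht.2]))
    _ ≤ ∫⁻ t in Ioc x (x + (k + 2)), ∫⁻ y in Ioc x (x + (k + 2)), ‖g t - g y‖ₑ :=
        lintegral_mono_set (Ioc_subset_Ioc_right (by linarith))
    _ ≤ _ := h x (k + 2) (by positivity)

/-! ### Campanato's argument -/

/-- Halving step: the mean of `|f - f x|` over an interval starting at `x` is compared with the
mean over the left half of the interval. -/
lemma HasOscBound.halving {f : ℝ → ℝ} (hf : Continuous f) {s M : ℝ} (h : HasOscBound s M f)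
    (x : ℝ) {r : ℝ} (hr : 0 < r) :
    ENNReal.ofReal (r / 2) * ∫⁻ y in Ioc x (x + r), ‖f y - f x‖ₑ ≤
      ENNReal.ofReal (M * r ^ (s + 3 / 2)) +
        ENNReal.ofReal r * ∫⁻ y in Ioc x (x + r / 2), ‖f y - f x‖ₑ := by
  have hfm := hf.measurable
  set A := ∫⁻ y in Ioc x (x + r / 2), ‖f y - f x‖ₑ
  calc ENNReal.ofReal (r / 2) * ∫⁻ y in Ioc x (x + r), ‖f y - f x‖ₑ
      = ∫⁻ y in Ioc x (x + r), ∫⁻ _z in Ioc x (x + r / 2), ‖f y - f x‖ₑ := by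
        rw [← lintegral_const_mul' _ _ ENNReal.ofReal_ne_top]
        refine lintegral_congr fun y => ?_
        rw [setLIntegral_const, Real.volume_Ioc, add_sub_cancel_left, mul_comm]
    _ ≤ ∫⁻ y in Ioc x (x + r), ((∫⁻ z in Ioc x (x + r), ‖f y - f z‖ₑ) + A) := by
        refine lintegral_mono fun y => ?_
        refine (lintegral_mono (g := fun z => ‖f y - f z‖ₑ + ‖f z - f x‖ₑ) fun z => ?_).trans ?_
        · rw [← sub_add_sub_cancel (f y) (f z) (f x)]
          exact enorm_add_le _ _
        · rw [lintegral_add_left (by fun_prop)]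
          gcongr
          linarith
    _ ≤ _ := by
        rw [lintegral_add_right _ measurable_const, setLIntegral_const, Real.volume_Ioc,
          add_sub_cancel_left, mul_comm A]
        gcongr
        exact h x r hr

/-- The case `k = 0`: if `s > 1 / 2`, summing the halving step over dyadic scales bounds the
mean distance between `f x` and the values of `f` on a unit interval. -/
lemma HasOscBound.lintegral_sub_le {f : ℝ → ℝ} (hf : Continuous f) {s M : ℝ} (hs : 1 / 2 < s)
    (hM : 0 ≤ M) (h : HasOscBound s M f) (x : ℝ) :
    ∫⁻ y in Ioc x (x + 1), ‖f y - f x‖ₑ ≤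
      ENNReal.ofReal (2 * M / (1 - (1 / 2) ^ (s - 1 / 2))) := by
  set q : ℝ := (1 / 2) ^ (s - 1 / 2) with hq
  have hq0 : 0 < q := Real.rpow_pos_of_pos (by norm_num) _
  have hq1 : q < 1 := Real.rpow_lt_one (by norm_num) (by norm_num) (by linarith)
  -- `T n` is the mean of `|f - f x|` over an interval of length `2⁻ⁿ`.
  set T : ℕ → ℝ≥0∞ := fun n =>
    ENNReal.ofReal (2 ^ n) * ∫⁻ y in Ioc x (x + (1 / 2) ^ n), ‖f y - f x‖ₑ with hT
  have hstep : ∀ n, T n ≤ ENNReal.ofReal (2 * M * q ^ n) + T (n + 1) := by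
    intro n
    have hr : (0 : ℝ) < (1 / 2) ^ n := by positivity
    have h1 := mul_le_mul_right (h.halving hf x hr) (ENNReal.ofReal (2 * 4 ^ n))
    have e2 : (2 : ℝ) ^ n * (1 / 2) ^ n = 1 := by rw [← mul_pow]; norm_num
    have e4 : (4 : ℝ) ^ n = 2 ^ n * 2 ^ n := by rw [← mul_pow]; norm_num
    rw [mul_add, ← mul_assoc, ← mul_assoc, ← ENNReal.ofReal_mul (by positivity),
      ← ENNReal.ofReal_mul (by positivity), ← ENNReal.ofReal_mul (by positivity)] at h1
    have a1 : 2 * (4 : ℝ) ^ n * ((1 / 2) ^ n / 2) = 2 ^ n := by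
      rw [e4]; linear_combination (2 : ℝ) ^ n * e2
    have a2 : 2 * (4 : ℝ) ^ n * (1 / 2) ^ n = 2 ^ (n + 1) := by
      rw [e4, pow_succ]; linear_combination 2 * (2 : ℝ) ^ n * e2
    have a3 : 2 * (4 : ℝ) ^ n * (M * ((1 / 2 : ℝ) ^ n) ^ (s + 3 / 2)) = 2 * M * q ^ n := by
      have : ((1 / 2 : ℝ) ^ n) ^ (s + 3 / 2) = q ^ n * ((1 / 2) ^ n * (1 / 2) ^ n) := by
        rw [hq, ← Real.rpow_natCast ((1 / 2 : ℝ) ^ (s - 1 / 2)), ← Real.rpow_mul (by norm_num),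
          ← Real.rpow_natCast, ← Real.rpow_mul (by norm_num), ← Real.rpow_add (by norm_num),
          ← Real.rpow_add (by norm_num)]
        congr 1; ring
      rw [this, e4]
      linear_combination (2 * M * q ^ n * (2 ^ n * (1 / 2) ^ n) + 2 * M * q ^ n) * e2
    have a4 : (1 / 2 : ℝ) ^ n / 2 = (1 / 2) ^ (n + 1) := by rw [pow_succ]; ring
    rw [a1, a2, a3, a4] at h1
    exact h1
  have hsum : ∀ n, T 0 ≤ ENNReal.ofReal (2 * M * ∑ j ∈ Finset.range n, q ^ j) + T n := by
    intro n
    induction n with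
    | zero => simp
    | succ n ih =>
      refine ih.trans ((add_le_add le_rfl (hstep n)).trans (le_of_eq ?_))
      rw [← add_assoc, ← ENNReal.ofReal_add (by positivity) (by positivity),
        Finset.sum_range_succ, mul_add]
  have hgeom : ∀ n, 2 * M * ∑ j ∈ Finset.range n, q ^ j ≤ 2 * M / (1 - q) := by
    intro n
    have h1 : (∑ j ∈ Finset.range n, q ^ j) * (1 - q) = 1 - q ^ n := geom_sum_mul_neg q n
    rw [le_div_iff₀ (by linarith), mul_assoc, h1]
    have : 0 < q ^ n := by positivity
    nlinarith
  have hT0 : T 0 = ∫⁻ y in Ioc x (x + 1), ‖f y - f x‖ₑ := by simp [hT]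
  rw [← hT0]
  refine ENNReal.le_of_forall_pos_le_add fun ε hε _ => ?_
  obtain ⟨δ, hδ, hfδ⟩ := Metric.continuousAt_iff.1 (hf.continuousAt (x := x)) ε hε
  obtain ⟨n, hn⟩ := exists_pow_lt_of_lt_one hδ (by norm_num : (1 / 2 : ℝ) < 1)
  refine (hsum n).trans (add_le_add (ENNReal.ofReal_le_ofReal (hgeom n)) ?_)
  calc T n ≤ ENNReal.ofReal (2 ^ n) * ∫⁻ _y in Ioc x (x + (1 / 2) ^ n), (ε : ℝ≥0∞) := by
        simp only [hT]
        refine mul_le_mul_right (setLIntegral_mono' measurableSet_Ioc fun y hy => ?_) _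
        have : dist (f y) (f x) < ε := hfδ (by
          rw [Real.dist_eq, abs_lt]; constructor <;> linarith [hy.1, hy.2])
        rw [dist_eq_norm] at this
        rw [enorm_le_coe]
        exact_mod_cast this.le
    _ = ε := by
        rw [setLIntegral_const, Real.volume_Ioc, add_sub_cancel_left, mul_left_comm,
          ← ENNReal.ofReal_mul (by positivity), ← mul_pow]
        norm_num

/-- The averaged forward difference of order `k + 1` is bounded by a multiple of the oscillation
constant of the `k`-th derivative as soon as `k + s > 1 / 2`. -/
lemma exists_lintegral_fwdDiff_le (k : ℕ) (s : ℝ) (hks : 1 / 2 < (k : ℝ) + s) :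
    ∃ C : ℝ, 0 < C ∧ ∀ (f : ℝ → ℝ) (M x : ℝ), ContDiff ℝ ∞ f → 0 ≤ M →
      HasOscBound s M (iteratedDeriv k f) →
        ∫⁻ r in Ioc (0 : ℝ) 1, ‖(fwdDiff r)^[k + 1] f x‖ₑ ≤ ENNReal.ofReal (C * M) := by
  cases k with
  | zero =>
    have hs : 1 / 2 < s := by simpa using hks
    have hq1 : (1 / 2 : ℝ) ^ (s - 1 / 2) < 1 :=
      Real.rpow_lt_one (by norm_num) (by norm_num) (by linarith)
    refine ⟨2 / (1 - (1 / 2) ^ (s - 1 / 2)), div_pos two_pos (by linarith),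
      fun f M x hf hM h => ?_⟩
    rw [iteratedDeriv_zero] at h
    have h1 := h.lintegral_sub_le hf.continuous hs hM x
    rw [div_mul_eq_mul_div]
    refine le_trans (le_of_eq ?_) h1
    have e : Ioc (0 : ℝ) 1 = (fun r => x + r) ⁻¹' Ioc x (x + 1) := by
      ext r; simp only [mem_Ioc, mem_preimage]; constructor <;> rintro ⟨h1, h2⟩ <;>
        constructor <;> linarith
    rw [e]
    exact (measurePreserving_add_left volume x).setLIntegral_comp_preimage_emb
      (measurableEmbedding_addLeft x) (fun y => ‖f y - f x‖ₑ) (Ioc x (x + 1))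
  | succ k =>
    refine ⟨((k : ℝ) + 2) ^ (s + 3 / 2), by positivity, fun f M x hf hM h => ?_⟩
    rw [mul_comm]
    exact lintegral_fwdDiff_le_of_succ hf k h x

/-! ### A parity obstruction -/

/-- Integer coefficients with odd sum cannot be combined with signs to give less than `1` in
absolute value. -/
lemma one_le_abs_sum_sign {ι : Type*} (S : Finset ι) (c σ : ι → ℤ) (hc : Odd (∑ i ∈ S, c i))
    (hσ : ∀ i ∈ S, σ i = 1 ∨ σ i = -1) : 1 ≤ |∑ i ∈ S, c i * σ i| := by
  have h2 : (2 : ℤ) ∣ ∑ i ∈ S, c i * σ i - ∑ i ∈ S, c i := by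
    rw [← Finset.sum_sub_distrib]
    refine Finset.dvd_sum fun i hi => ?_
    rcases hσ i hi with h | h <;> rw [h]
    · simp
    · exact ⟨-c i, by ring⟩
  refine Int.one_le_abs fun h0 => ?_
  rw [h0] at h2
  rw [← Int.not_even_iff_odd, even_iff_two_dvd] at hc
  exact hc (by simpa using h2)
/-- The forward difference of order `k + 1` at a zero `x` of `f` is bounded below when the other
values of `f` that enter it are close to `±1`: the binomial coefficients other than the one that
multiplies `f x` have the odd sum `2 ^ (k + 1) - 1`. -/
lemma half_le_abs_fwdDiff_iter {f : ℝ → ℝ} {x r : ℝ} (k : ℕ) (hx : f x = 0)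
    (h : ∀ j < k + 1, |(|f (x + (j + 1 : ℕ) * r)| - 1)| < 1 / 2 ^ (k + 2)) :
    1 / 2 ≤ |(fwdDiff r)^[k + 1] f x| := by
  set c : ℕ → ℤ := fun j => (-1) ^ (k + 1 - (j + 1)) * ((k + 1).choose (j + 1) : ℤ) with hcdef
  set σ : ℕ → ℤ := fun j => if 0 ≤ f (x + (j + 1 : ℕ) * r) then 1 else -1 with hσdef
  have hσ : ∀ j, σ j = 1 ∨ σ j = -1 := fun j => by
    simp only [hσdef]; split_ifs <;> simp
  have hfσ : ∀ j < k + 1, |f (x + (j + 1 : ℕ) * r) - σ j| ≤ 1 / 2 ^ (k + 2) := by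
    intro j hj
    have := h j hj
    simp only [hσdef]
    split_ifs with h0
    · rw [abs_of_nonneg h0] at this; push_cast at this ⊢; exact this.le
    · rw [abs_of_neg (not_le.1 h0), abs_sub_comm] at this
      push_cast at this ⊢
      rw [show ∀ y : ℝ, y - -1 = 1 - -y from fun y => by ring]
      exact this.le
  have hchoose : ∑ j ∈ Finset.range (k + 1), ((k + 1).choose (j + 1) : ℤ) = 2 ^ (k + 1) - 1 := by
    have := Nat.sum_range_choose (k + 1)
    rw [Finset.sum_range_succ'] at this
    have h' : (∑ j ∈ Finset.range (k + 1), ((k + 1).choose (j + 1) : ℤ)) + 1 = 2 ^ (k + 1) := by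
      exact_mod_cast this
    linarith
  have hodd : Odd (∑ j ∈ Finset.range (k + 1), c j) := by
    have h2 : (2 : ℤ) ∣ ∑ j ∈ Finset.range (k + 1), c j -
        ∑ j ∈ Finset.range (k + 1), ((k + 1).choose (j + 1) : ℤ) := by
      rw [← Finset.sum_sub_distrib]
      refine Finset.dvd_sum fun j _ => ?_
      simp only [hcdef]
      rcases neg_one_pow_eq_or ℤ (k + 1 - (j + 1)) with e | e <;> rw [e]
      · simp
      · exact ⟨-((k + 1).choose (j + 1) : ℤ), by ring⟩
    rw [hchoose] at h2
    obtain ⟨m, hm⟩ := h2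
    exact ⟨m + 2 ^ k - 1, by rw [pow_succ] at hm; linarith⟩
  have hN := one_le_abs_sum_sign (Finset.range (k + 1)) c σ hodd fun j _ => hσ j
  have hN' : (1 : ℝ) ≤ |∑ j ∈ Finset.range (k + 1), (c j : ℝ) * σ j| := by exact_mod_cast hN
  have hD : (fwdDiff r)^[k + 1] f x =
      ∑ j ∈ Finset.range (k + 1), (c j : ℝ) * f (x + (j + 1 : ℕ) * r) := by
    rw [fwdDiff_iter_eq_sum_shift, Finset.sum_range_succ', zero_smul, add_zero, hx, smul_zero,
      add_zero]
    refine Finset.sum_congr rfl fun j _ => ?_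
    simp only [hcdef, zsmul_eq_mul, nsmul_eq_mul]
  have habs : ∀ j, |(c j : ℝ)| = ((k + 1).choose (j + 1) : ℝ) := by
    intro j
    simp only [hcdef]
    push_cast
    rw [abs_mul, abs_pow, abs_neg, abs_one, one_pow, one_mul, Nat.abs_cast]
  have hdiff : |(fwdDiff r)^[k + 1] f x - ∑ j ∈ Finset.range (k + 1), (c j : ℝ) * σ j| ≤ 1 / 2 := by
    rw [hD, ← Finset.sum_sub_distrib]
    calc |∑ j ∈ Finset.range (k + 1), ((c j : ℝ) * f (x + (j + 1 : ℕ) * r) - c j * σ j)|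
        ≤ ∑ j ∈ Finset.range (k + 1), ((k + 1).choose (j + 1) : ℝ) * (1 / 2 ^ (k + 2)) := by
          refine (Finset.abs_sum_le_sum_abs _ _).trans (Finset.sum_le_sum fun j hj => ?_)
          rw [← mul_sub, abs_mul, habs]
          exact mul_le_mul_of_nonneg_left (hfσ j (Finset.mem_range.1 hj)) (by positivity)
      _ ≤ 1 / 2 := by
          rw [← Finset.sum_mul]
          have : ∑ j ∈ Finset.range (k + 1), ((k + 1).choose (j + 1) : ℝ) = 2 ^ (k + 1) - 1 := by
            exact_mod_cast hchoose
          rw [this, mul_one_div, div_le_div_iff₀ (by positivity) two_pos, pow_succ 2 (k + 1)]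
          linarith
  have := abs_sub_abs_le_abs_sub (∑ j ∈ Finset.range (k + 1), (c j : ℝ) * σ j)
    ((fwdDiff r)^[k + 1] f x)
  rw [abs_sub_comm] at hdiff
  linarith

/-- A function with a zero whose averaged forward differences at that zero are small stays away
from `±1` on a set of definite measure. -/
lemma le_measure_of_zero {f : ℝ → ℝ} (hf : Continuous f) {x : ℝ} (hx : f x = 0) (k : ℕ) :
    1 ≤ 2 * (∫⁻ r in Ioc (0 : ℝ) 1, ‖(fwdDiff r)^[k + 1] f x‖ₑ) + (k + 1) *
      volume ({t | 1 / 2 ^ (k + 2) ≤ |(|f t| - 1)|} ∩ Ioc x (x + (k + 1))) := by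
  set B := {t | 1 / 2 ^ (k + 2) ≤ |(|f t| - 1)|} ∩ Ioc x (x + (k + 1))
  have hDm : Measurable fun r => ‖(fwdDiff r)^[k + 1] f x‖ₑ := by
    have hfm := hf.measurable
    simp only [fwdDiff_iter_eq_sum_shift, zsmul_eq_mul, nsmul_eq_mul]
    fun_prop
  -- For each step `r`, either the difference is large or some sample point `x + (j + 1) r` lies
  -- in `B`; the dilation by `j + 1 ≥ 1` does not increase the measure of the preimage of `B`.
  have hcover : Ioc (0 : ℝ) 1 ⊆ {r | 2⁻¹ ≤ ‖(fwdDiff r)^[k + 1] f x‖ₑ} ∩ Ioc (0 : ℝ) 1 ∪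
      ⋃ j ∈ Finset.range (k + 1), (fun r : ℝ => ((j + 1 : ℕ) : ℝ) * r) ⁻¹'
        ((fun t => x + t) ⁻¹' B) := by
    intro r hr
    by_cases hgood : ∀ j < k + 1, |(|f (x + (j + 1 : ℕ) * r)| - 1)| < 1 / 2 ^ (k + 2)
    · left
      refine ⟨?_, hr⟩
      have := half_le_abs_fwdDiff_iter k hx hgood
      rw [mem_ofPred_eq, ← ofReal_norm, Real.norm_eq_abs]
      refine le_trans (le_of_eq ?_) (ENNReal.ofReal_le_ofReal this)
      rw [one_div, ENNReal.ofReal_inv_of_pos two_pos]; simp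
    · right
      push Not at hgood
      obtain ⟨j, hj, hjB⟩ := hgood
      simp only [mem_iUnion, Finset.mem_range, mem_preimage]
      refine ⟨j, hj, hjB, ?_, ?_⟩
      · have : 0 < ((j + 1 : ℕ) : ℝ) * r := mul_pos (by positivity) hr.1
        linarith
      · have h1 : ((j + 1 : ℕ) : ℝ) ≤ k + 1 := by exact_mod_cast hj
        have : ((j + 1 : ℕ) : ℝ) * r ≤ (k + 1) * 1 :=
          mul_le_mul h1 hr.2 hr.1.le (by positivity)
        linarith
  calc (1 : ℝ≥0∞) = volume (Ioc (0 : ℝ) 1) := by simp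
    _ ≤ volume ({r | 2⁻¹ ≤ ‖(fwdDiff r)^[k + 1] f x‖ₑ} ∩ Ioc (0 : ℝ) 1) +
        ∑ j ∈ Finset.range (k + 1), volume
          ((fun r : ℝ => ((j + 1 : ℕ) : ℝ) * r) ⁻¹' ((fun t => x + t) ⁻¹' B)) :=
        (measure_mono hcover).trans ((measure_union_le _ _).trans
          (add_le_add le_rfl (measure_biUnion_finset_le _ _)))
    _ ≤ 2 * (∫⁻ r in Ioc (0 : ℝ) 1, ‖(fwdDiff r)^[k + 1] f x‖ₑ) + (k + 1) * volume B := by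
        refine add_le_add ?_ ?_
        · have := mul_meas_ge_le_lintegral (μ := volume.restrict (Ioc (0 : ℝ) 1)) hDm 2⁻¹
          rw [Measure.restrict_apply (measurableSet_le measurable_const hDm)] at this
          refine le_trans (le_of_eq ?_) (mul_le_mul_right this 2)
          rw [← mul_assoc, ENNReal.mul_inv_cancel (by norm_num) (by norm_num), one_mul]
        · refine (Finset.sum_le_sum (g := fun _ => volume B) fun j _ => ?_).trans (le_of_eq ?_)
          · rw [Real.volume_preimage_mul_left (by positivity), measure_preimage_add]
            refine mul_le_of_le_one_left' ?_
            rw [ENNReal.ofReal_le_one, abs_of_pos (by positivity)]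
            refine inv_le_one_of_one_le₀ ?_
            exact_mod_cast Nat.succ_le_succ (Nat.zero_le j)
          · simp

/-! ### Jumps of sign functions -/

lemma nhdsLT_inf_ae_neBot (t : ℝ) : NeBot (𝓝[<] t ⊓ ae (volume : Measure ℝ)) := by
  rw [inf_neBot_iff]
  intro s hs s' hs'
  obtain ⟨l, hl, hls⟩ := (mem_nhdsLT_iff_exists_Ioo_subset).1 hs
  by_contra hne
  rw [not_nonempty_iff_eq_empty] at hne
  have hsub : Ioo l t ⊆ s'ᶜ := fun x hx hx' => by
    have : x ∈ s ∩ s' := ⟨hls hx, hx'⟩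
    simp [hne] at this
  have := measure_mono_null hsub hs'
  rw [Real.volume_Ioo, ENNReal.ofReal_eq_zero] at this
  linarith [show l < t from hl]

lemma nhdsGT_inf_ae_neBot (t : ℝ) : NeBot (𝓝[>] t ⊓ ae (volume : Measure ℝ)) := by
  rw [inf_neBot_iff]
  intro s hs s' hs'
  obtain ⟨l, hl, hls⟩ := (mem_nhdsGT_iff_exists_Ioo_subset).1 hs
  by_contra hne
  rw [not_nonempty_iff_eq_empty] at hne
  have hsub : Ioo t l ⊆ s'ᶜ := fun x hx hx' => by
    have : x ∈ s ∩ s' := ⟨hls hx, hx'⟩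
    simp [hne] at this
  have := measure_mono_null hsub hs'
  rw [Real.volume_Ioo, ENNReal.ofReal_eq_zero] at this
  linarith [show t < l from hl]

lemma nhds_inf_ae_eq_sup (t : ℝ) : 𝓝 t ⊓ ae (volume : Measure ℝ) =
    (𝓝[<] t ⊓ ae volume) ⊔ (𝓝[>] t ⊓ ae volume) := by
  rw [← inf_sup_right, nhdsLT_sup_nhdsGT, nhdsWithin, inf_assoc,
    inf_eq_right.2 (le_principal_iff.2 (compl_mem_ae_iff.2 (measure_singleton t)))]

/-- A limit of a function with values `±1` is one of these values, and it is attained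
eventually. -/
lemma eventually_eq_of_tendsto_sign {F : Filter ℝ} [NeBot F] {u : ℝ → ℝ} {l : ℝ}
    (hu : ∀ᶠ x in F, u x = 1 ∨ u x = -1) (hl : Tendsto u F (𝓝 l)) :
    (l = 1 ∨ l = -1) ∧ ∀ᶠ x in F, u x = l := by
  have h1 : l ∈ ({1, -1} : Set ℝ) :=
    (toFinite ({1, -1} : Set ℝ)).isClosed.mem_of_tendsto hl (hu.mono fun x hx => by simpa using hx)
  have h1' : l = 1 ∨ l = -1 := by simpa using h1
  refine ⟨h1', ?_⟩
  filter_upwards [hu, hl (Metric.ball_mem_nhds l one_pos)] with x hx hx'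
  rw [mem_preimage, Metric.mem_ball, Real.dist_eq, abs_lt] at hx'
  rcases hx with hx | hx <;> rcases h1' with h | h <;> rw [hx, h] at hx' <;>
    first | (norm_num at hx'; done) | rw [hx, h]

/-- A sign function of bounded variation without jumps is locally constant up to null sets, hence
constant by connectedness of the interval. -/
lemma IsSignBV.exists_jump {u : ℝ → ℝ} (hu : IsSignBV u)
    (hc : ¬ ∃ c : ℝ, ∀ᵐ x ∂(volume.restrict (Ioo (0 : ℝ) 1)), u x = c) :
    ∃ t ∈ Ioo (0 : ℝ) 1, ∃ l r : ℝ, HasOneSidedLimits u t l r ∧ l ≠ r := by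
  obtain ⟨hsign, v, hv, huv⟩ := hu
  rw [ae_restrict_iff' measurableSet_Ioo] at hsign huv
  by_contra! hno
  -- The one-sided limits of the representative `v` are essential limits of `u`.
  have hloc : ∀ t ∈ Ioo (0 : ℝ) 1, ∃ l : ℝ, (l = 1 ∨ l = -1) ∧
      ∀ᶠ x in 𝓝 t ⊓ ae volume, u x = l := by
    intro t ht
    have hI : ∀ᶠ x in 𝓝 t ⊓ ae volume, x ∈ Ioo (0 : ℝ) 1 :=
      mem_inf_of_left (isOpen_Ioo.mem_nhds ht)
    have hs : ∀ᶠ x in 𝓝 t ⊓ ae volume, u x = 1 ∨ u x = -1 := by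
      filter_upwards [hI, hsign.filter_mono inf_le_right] with x h1 h2 using h2 h1
    have he : ∀ᶠ x in 𝓝 t ⊓ ae volume, u x = v x := by
      filter_upwards [hI, huv.filter_mono inf_le_right] with x h1 h2 using h2 h1
    have hleL : 𝓝[<] t ⊓ ae volume ≤ 𝓝 t ⊓ ae volume := inf_le_inf_right _ nhdsWithin_le_nhds
    have hleR : 𝓝[>] t ⊓ ae volume ≤ 𝓝 t ⊓ ae volume := inf_le_inf_right _ nhdsWithin_le_nhds
    obtain ⟨l, hl⟩ := hv.exists_tendsto_left t
    obtain ⟨r, hr⟩ := hv.exists_tendsto_right t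
    rw [nhdsWithin_inter_of_mem (mem_nhdsWithin_of_mem_nhds (isOpen_Ioo.mem_nhds ht))] at hl hr
    have hl' : Tendsto u (𝓝[<] t ⊓ ae volume) (𝓝 l) :=
      (hl.mono_left inf_le_left).congr' ((he.filter_mono hleL).mono fun x hx => hx.symm)
    have hr' : Tendsto u (𝓝[>] t ⊓ ae volume) (𝓝 r) :=
      (hr.mono_left inf_le_left).congr' ((he.filter_mono hleR).mono fun x hx => hx.symm)
    have hlr : l = r := hno t ht l r ⟨hl', hr'⟩
    have := nhdsLT_inf_ae_neBot t
    have := nhdsGT_inf_ae_neBot t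
    obtain ⟨h1, h2⟩ := eventually_eq_of_tendsto_sign (hs.filter_mono hleL) hl'
    obtain ⟨-, h3⟩ := eventually_eq_of_tendsto_sign (hs.filter_mono hleR) hr'
    refine ⟨l, h1, ?_⟩
    rw [nhds_inf_ae_eq_sup, eventually_sup]
    exact ⟨h2, hlr ▸ h3⟩
  have hopen : ∀ c : ℝ, IsOpen {t : ℝ | ∀ᶠ x in 𝓝 t ⊓ ae volume, u x = c} := by
    intro c
    rw [isOpen_iff_mem_nhds]
    intro t ht
    obtain ⟨V, hV, N, hN, hVN⟩ := mem_inf_iff_superset.1 ht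
    filter_upwards [eventually_mem_nhds_iff.2 hV] with t' ht'
    exact mem_inf_iff_superset.2 ⟨V, ht', N, hN, hVN⟩
  have hconst : ∀ c : ℝ, Ioo (0 : ℝ) 1 ⊆ {t : ℝ | ∀ᶠ x in 𝓝 t ⊓ ae volume, u x = c} →
      ∀ᵐ x ∂(volume.restrict (Ioo (0 : ℝ) 1)), u x = c := by
    intro c hsub
    rw [ae_restrict_iff' measurableSet_Ioo]
    have : volume {x | x ∈ Ioo (0 : ℝ) 1 ∧ u x ≠ c} = 0 := by
      refine measure_null_of_locally_null _ fun t ht => ?_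
      obtain ⟨V, hV, N, hN, hVN⟩ := mem_inf_iff_superset.1 (hsub ht.1)
      refine ⟨V ∩ {x | x ∈ Ioo (0 : ℝ) 1 ∧ u x ≠ c},
        inter_mem (mem_nhdsWithin_of_mem_nhds hV) self_mem_nhdsWithin,
        measure_mono_null (fun x hx hxN => hx.2.2 (hVN ⟨hx.1, hxN⟩)) hN⟩
    rw [ae_iff]
    simpa only [Classical.not_imp] using this
  have hdisj : Disjoint {t : ℝ | ∀ᶠ x in 𝓝 t ⊓ ae volume, u x = 1}
      {t : ℝ | ∀ᶠ x in 𝓝 t ⊓ ae volume, u x = -1} := by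
    rw [Set.disjoint_left]
    intro t h1 h2
    have : NeBot (𝓝 t ⊓ ae volume) :=
      (nhdsLT_inf_ae_neBot t).mono (inf_le_inf_right _ nhdsWithin_le_nhds)
    rw [mem_ofPred_eq] at h1 h2
    obtain ⟨x, h1, h2⟩ := (h1.and h2).exists
    rw [h1] at h2; norm_num at h2
  have hcover : Ioo (0 : ℝ) 1 ⊆ {t : ℝ | ∀ᶠ x in 𝓝 t ⊓ ae volume, u x = 1} ∪
      {t : ℝ | ∀ᶠ x in 𝓝 t ⊓ ae volume, u x = -1} := by
    intro t ht
    obtain ⟨l, hl | hl, h⟩ := hloc t ht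
    · exact Or.inl (hl ▸ h)
    · exact Or.inr (hl ▸ h)
  rcases IsPreconnected.subset_or_subset (hopen 1) (hopen (-1)) hdisj hcover
    isPreconnected_Ioo with h | h
  · exact hc ⟨1, hconst 1 h⟩
  · exact hc ⟨-1, hconst (-1) h⟩

/-! ### Transitions cost energy -/

lemma IsWeakDeriv.congr_ae {k : ℕ} {v w w' : ℝ → ℝ} (h : IsWeakDeriv k v w)
    (hw : w =ᵐ[volume] w') : IsWeakDeriv k v w' := by
  refine ⟨h.1, fun x => ?_, fun φ h1 h2 => ?_⟩
  · exact (locallyIntegrable_congr hw).1 h.2.1 x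
  · rw [h.2.2 φ h1 h2]
    congr 1
    refine integral_congr_ae ?_
    filter_upwards [hw] with x hx
    rw [hx]

lemma gagliardoEnergy_congr_ae (s : ℝ) (a : ℝ → ℝ → ℝ) {w w' : ℝ → ℝ} (hw : w =ᵐ[volume] w')
    (I : Set ℝ) : gagliardoEnergy s a w I = gagliardoEnergy s a w' I := by
  refine lintegral_congr_ae (ae_restrict_of_ae ?_)
  filter_upwards [Measure.quasiMeasurePreserving_fst.ae_eq_comp hw,
    Measure.quasiMeasurePreserving_snd.ae_eq_comp hw] with p h1 h2
  simp only [Function.comp_apply] at h1 h2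
  rw [h1, h2]

/-- The standard mollifiers at scale `1 / (n + 1)`. -/
noncomputable def stdBump (n : ℕ) : ContDiffBump (0 : ℝ) where
  rIn := 1 / (2 * ((n : ℝ) + 1))
  rOut := 1 / ((n : ℝ) + 1)
  rIn_pos := by positivity
  rIn_lt_rOut := by
    rw [div_lt_div_iff₀ (by positivity) (by positivity)]
    have : (0 : ℝ) ≤ n := by positivity
    linarith

lemma lintegral_enorm_normed_stdBump (n : ℕ) :
    ∫⁻ z, ‖(stdBump n).normed volume z‖ₑ = 1 := by
  have h := (stdBump n).integral_normed (μ := (volume : Measure ℝ))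
  have h2 := ofReal_integral_eq_lintegral_ofReal ((stdBump n).integrable_normed (μ := volume))
    (ae_of_all _ fun x => (stdBump n).nonneg_normed x)
  rw [h, ENNReal.ofReal_one] at h2
  rw [h2]
  refine lintegral_congr fun z => ?_
  rw [← ofReal_norm, Real.norm_of_nonneg ((stdBump n).nonneg_normed z)]

/-- A continuous function that is close to opposite nonzero values at the ends of an interval
vanishes inside. -/
lemma exists_zero_of_near_sign {f : ℝ → ℝ} (hf : Continuous f) {σ R : ℝ} (hR : 0 ≤ R)
    (hσ : σ = 1 ∨ σ = -1) (h1 : |f R - σ| ≤ 1 / 2) (h2 : |f (-R) - -σ| ≤ 1 / 2) :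
    ∃ x ∈ Icc (-R) R, f x = 0 := by
  rw [abs_le] at h1 h2
  rcases hσ with rfl | rfl
  · exact intermediate_value_Icc (by linarith) hf.continuousOn
      ⟨by linarith [h2.2], by linarith [h1.1]⟩
  · exact intermediate_value_Icc' (by linarith) hf.continuousOn
      ⟨by linarith [h1.2], by linarith [h2.1]⟩

/-- A transition between the wells cannot have both a small Gagliardo seminorm and values close
to `±1` outside a small set. -/
lemma exists_transition_obstruction (k : ℕ) {s : ℝ} (hs : 0 < s) (hks : 1 / 2 < (k : ℝ) + s) :
    ∃ δ : ℝ, 0 < δ ∧ ∀ (v w : ℝ → ℝ) (σ : ℝ), (σ = 1 ∨ σ = -1) → IsWeakDeriv k v w →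
      Tendsto v atTop (𝓝 σ) → Tendsto v atBot (𝓝 (-σ)) →
      gagliardoEnergy s (fun _ _ => 1) w univ ≤ ENNReal.ofReal δ →
      ENNReal.ofReal δ < volume {x | 1 / 2 ^ (k + 3) ≤ |(|v x| - 1)|} := by
  obtain ⟨C, hC, hCf⟩ := exists_lintegral_fwdDiff_le k s hks
  -- With `M = 1 / (8 * C)` the averaged difference contributes at most `1 / 4`, and each of the
  -- two exceptional sets below contributes at most `1 / 4`.
  set M : ℝ := 1 / (8 * C) with hM
  set m : ℝ := 1 / (4 * ((k : ℝ) + 1)) with hm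
  have hMpos : 0 < M := by positivity
  have hmpos : 0 < m := by positivity
  refine ⟨min (M ^ 2) m, lt_min (by positivity) hmpos, ?_⟩
  intro v w₀ σ hσ hw₀ htop hbot hE₀
  by_contra! hbad
  -- A measurable representative of the weak derivative makes Tonelli's theorem applicable.
  obtain ⟨w, hwm, hww⟩ : ∃ w, Measurable w ∧ w₀ =ᵐ[volume] w :=
    ⟨_, hw₀.2.1.aestronglyMeasurable.stronglyMeasurable_mk.measurable,
      hw₀.2.1.aestronglyMeasurable.ae_eq_mk⟩
  have hw : IsWeakDeriv k v w := hw₀.congr_ae hww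
  rw [gagliardoEnergy_congr_ae s _ hww] at hE₀
  have hosc : HasOscBound s M w := hasOscBound_of_gagliardoEnergy_le hs hMpos hwm
    (hE₀.trans (ENNReal.ofReal_le_ofReal (min_le_left _ _)))
  set f : ℕ → ℝ → ℝ := fun n =>
    convolution ((stdBump n).normed volume) v (ContinuousLinearMap.lsmul ℝ ℝ) volume with hf
  have hfs : ∀ n, ContDiff ℝ ∞ (f n) := fun n =>
    (stdBump n).hasCompactSupport_normed.contDiff_convolution_left _
      (stdBump n).contDiff_normed hw.1
  have hfosc : ∀ n, HasOscBound s M (iteratedDeriv k (f n)) := by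
    intro n
    simp only [hf]
    rw [hw.iteratedDeriv_convolution (stdBump n).contDiff_normed
      (stdBump n).hasCompactSupport_normed]
    exact hosc.mollify hwm hw.2.1 (stdBump n).continuous_normed
      (stdBump n).hasCompactSupport_normed (lintegral_enorm_normed_stdBump n)
  have hball : ∀ n, Function.support ((stdBump n).normed (volume : Measure ℝ)) ⊆
      Metric.ball 0 1 := by
    intro n
    rw [(stdBump n).support_normed_eq]
    refine Metric.ball_subset_ball ?_
    have : (0 : ℝ) ≤ n := by positivity
    exact (div_le_one (by positivity)).2 (by linarith)
  have hnear : ∀ n x σ', (∀ y ∈ Metric.ball x 1, dist (v y) σ' ≤ 1 / 2) →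
      dist (f n x) σ' ≤ 1 / 2 := fun n x σ' h =>
    dist_convolution_le (by norm_num) (hball n) (fun x => (stdBump n).nonneg_normed x)
      ((stdBump n).integral_normed) hw.1.aestronglyMeasurable h
  obtain ⟨R₁, hR₁⟩ := eventually_atTop.1 (htop (Metric.closedBall_mem_nhds σ one_half_pos))
  obtain ⟨R₂, hR₂⟩ := eventually_atBot.1 (hbot (Metric.closedBall_mem_nhds (-σ) one_half_pos))
  set R : ℝ := max (max R₁ (-R₂)) 0 + 1 with hR
  have hR0 : 0 ≤ R := by positivity
  have hRR₁ : R₁ ≤ R - 1 := by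
    rw [hR, add_sub_cancel_right]; exact (le_max_left _ _).trans (le_max_left _ _)
  have hRR₂ : -R₂ ≤ R - 1 := by
    rw [hR, add_sub_cancel_right]; exact (le_max_right _ _).trans (le_max_left _ _)
  have hzero : ∀ n, ∃ x ∈ Icc (-R) R, f n x = 0 := by
    intro n
    refine exists_zero_of_near_sign (hfs n).continuous hR0 hσ (hnear n R σ fun y hy => ?_)
      (hnear n (-R) (-σ) fun y hy => ?_)
    · rw [Metric.mem_ball, Real.dist_eq, abs_lt] at hy
      exact hR₁ y (by linarith [hy.1])
    · rw [Metric.mem_ball, Real.dist_eq, abs_lt] at hy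
      exact hR₂ y (by linarith [hy.2])
  have hae : ∀ᵐ x, Tendsto (fun n => f n x) atTop (𝓝 (v x)) := by
    refine ContDiffBump.ae_convolution_tendsto_right_of_locallyIntegrable (φ := stdBump) (K := 2)
      tendsto_one_div_add_atTop_nhds_zero_nat (Eventually.of_forall fun n => ?_) hw.1
    simp only [stdBump]
    field_simp
    exact le_rfl
  have hmeas := tendstoInMeasure_of_tendsto_ae
    (μ := volume.restrict (Icc (-R) (R + (k + 1))))
    (fun n => (hfs n).continuous.aestronglyMeasurable) (ae_restrict_of_ae hae)
  have hlim := tendstoInMeasure_iff_dist.1 hmeas (1 / 2 ^ (k + 3)) (by positivity)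
  obtain ⟨n, hn⟩ := (hlim.eventually_le_const
    (ENNReal.ofReal_pos.2 hmpos)).exists
  obtain ⟨x, hxR, hx⟩ := hzero n
  have hmain := le_measure_of_zero (hfs n).continuous hx k
  have hdiff := hCf (f n) M x (hfs n) hMpos.le (hfosc n)
  have hB : volume ({t | 1 / 2 ^ (k + 2) ≤ |(|f n t| - 1)|} ∩ Ioc x (x + (k + 1))) ≤
      ENNReal.ofReal (m + m) := by
    have hsub : {t | 1 / 2 ^ (k + 2) ≤ |(|f n t| - 1)|} ∩ Ioc x (x + (k + 1)) ⊆
        {t | 1 / 2 ^ (k + 3) ≤ |(|v t| - 1)|} ∪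
          ({t | 1 / 2 ^ (k + 3) ≤ dist (f n t) (v t)} ∩ Icc (-R) (R + (k + 1))) := by
      rintro t ⟨ht, htI⟩
      by_cases h1 : 1 / 2 ^ (k + 3) ≤ |(|v t| - 1)|
      · exact Or.inl h1
      · refine Or.inr ⟨?_, by linarith [hxR.1, htI.1], by linarith [hxR.2, htI.2]⟩
        rw [mem_ofPred_eq] at ht ⊢
        have e : (1 : ℝ) / 2 ^ (k + 2) = 1 / 2 ^ (k + 3) + 1 / 2 ^ (k + 3) := by
          rw [pow_succ 2 (k + 2)]; field_simp; norm_num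
        have h2 : |(|f n t| - 1)| ≤ |(|f n t| - |v t|)| + |(|v t| - 1)| := abs_sub_le _ _ _
        have h3 := abs_abs_sub_abs_le_abs_sub (f n t) (v t)
        rw [Real.dist_eq]
        linarith
    rw [ENNReal.ofReal_add hmpos.le hmpos.le]
    refine (measure_mono hsub).trans ((measure_union_le _ _).trans (add_le_add ?_ ?_))
    · exact hbad.trans (ENNReal.ofReal_le_ofReal (min_le_right _ _))
    · refine le_trans ?_ hn
      exact Measure.le_restrict_apply _ _
  have hfin : (1 : ℝ≥0∞) ≤ ENNReal.ofReal (2 * (C * M) + (k + 1) * (m + m)) := by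
    refine hmain.trans ?_
    rw [ENNReal.ofReal_add (by positivity) (by positivity), ENNReal.ofReal_mul two_pos.le,
      ENNReal.ofReal_mul (p := (k : ℝ) + 1) (by positivity), ENNReal.ofReal_ofNat,
      ENNReal.ofReal_add (p := (k : ℝ)) (by positivity) one_pos.le, ENNReal.ofReal_natCast,
      ENNReal.ofReal_one]
    gcongr
  have e : 2 * (C * M) + ((k : ℝ) + 1) * (m + m) = 3 / 4 := by
    rw [hM, hm]; field_simp; norm_num
  rw [e, ← ENNReal.ofReal_one, ENNReal.ofReal_le_ofReal_iff (by norm_num)] at hfin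
  norm_num at hfin

lemma IsDoubleWell.exists_lower_bound {W : ℝ → ℝ} (hW : IsDoubleWell W) {θ : ℝ} (hθ : 0 < θ) :
    ∃ c : ℝ, 0 < c ∧ ∀ z : ℝ, θ ≤ |(|z| - 1)| → c ≤ W z := by
  obtain ⟨α, β, hα, -, h⟩ := hW.quadratic
  obtain ⟨c, hc, hc'⟩ := hW.away
  refine ⟨min (α * θ ^ 2) c, lt_min (by positivity) hc, fun z hz => ?_⟩
  rcases le_total |z| 2 with h2 | h2
  · refine (min_le_left _ _).trans (le_trans ?_ (h z h2).1)
    have : θ ^ 2 ≤ (1 - |z|) ^ 2 := by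
      rw [← sq_abs (1 - |z|), abs_sub_comm]
      exact pow_le_pow_left₀ hθ.le hz 2
    gcongr
  · exact (min_le_right _ _).trans (hc' z h2)

lemma ofReal_mul_gagliardoEnergy_le {s α : ℝ} {b : ℝ → ℝ → ℝ} (hα : 0 ≤ α)
    (hb : ∀ᵐ p : ℝ × ℝ, α ≤ b p.1 p.2) (w : ℝ → ℝ) (I : Set ℝ) :
    ENNReal.ofReal α * gagliardoEnergy s (fun _ _ => 1) w I ≤ gagliardoEnergy s b w I := by
  unfold gagliardoEnergy
  rw [← lintegral_const_mul' _ _ ENNReal.ofReal_ne_top]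
  refine lintegral_mono_ae (ae_restrict_of_ae ?_)
  filter_upwards [hb] with p hp
  rw [← ENNReal.ofReal_mul hα, one_mul]
  refine ENNReal.ofReal_le_ofReal (mul_le_mul_of_nonneg_right hp (by positivity))

/-- Transition energies are positive for every kernel with a positive lower bound. -/
lemma transitionEnergy_pos {W : ℝ → ℝ} (hW : IsDoubleWell W) {k : ℕ} {s : ℝ} (hs : 0 < s)
    (hks : 1 / 2 < (k : ℝ) + s) {b : ℝ → ℝ → ℝ} {α : ℝ} (hα : 0 < α)
    (hb : ∀ᵐ p : ℝ × ℝ, α ≤ b p.1 p.2) {σ : ℝ} (hσ : σ = 1 ∨ σ = -1) :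
    0 < transitionEnergy W k s σ b := by
  obtain ⟨δ, hδ, hobs⟩ := exists_transition_obstruction k hs hks
  obtain ⟨c, hc, hcW⟩ := hW.exists_lower_bound (θ := 1 / 2 ^ (k + 3)) (by positivity)
  have hpos : 0 < min (ENNReal.ofReal (α * δ)) (ENNReal.ofReal (c * δ)) :=
    lt_min (ENNReal.ofReal_pos.2 (by positivity)) (ENNReal.ofReal_pos.2 (by positivity))
  refine hpos.trans_le (le_sInf ?_)
  rintro E ⟨v, hv, htop, hbot, rfl⟩
  have hderiv : IsWeakDeriv k v (weakDeriv k v) := by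
    have h := (hv.1 k le_rfl).1
    rw [weakDeriv, dif_pos h]
    exact h.choose_spec
  unfold rescaledEnergy
  by_cases hG : gagliardoEnergy s (fun _ _ => 1) (weakDeriv k v) univ ≤ ENNReal.ofReal δ
  · refine (min_le_right _ _).trans (le_trans ?_ le_self_add)
    have hvol := hobs v _ σ hσ hderiv htop hbot hG
    have hvm : AEMeasurable (fun x => ENNReal.ofReal (W (v x))) volume :=
      (hW.continuous.measurable.comp_aemeasurable
        hderiv.1.aestronglyMeasurable.aemeasurable).ennreal_ofReal
    rw [Measure.restrict_univ, ENNReal.ofReal_mul hc.le]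
    refine le_trans ?_ (mul_meas_ge_le_lintegral₀ hvm (ENNReal.ofReal c))
    refine mul_le_mul_right (hvol.le.trans (measure_mono fun x hx => ?_)) _
    exact ENNReal.ofReal_le_ofReal (hcW _ hx)
  · refine (min_le_left _ _).trans (le_trans ?_ le_add_self)
    refine le_trans ?_ (ofReal_mul_gagliardoEnergy_le hα.le hb _ _)
    rw [ENNReal.ofReal_mul hα.le]
    exact mul_le_mul_right (not_le.1 hG).le _

/-! ### Nontriviality of the limit energies -/

lemma ae_le_comp_div {a : ℝ → ℝ → ℝ} {α l : ℝ} (hl : l ≠ 0)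
    (ha : ∀ᵐ p : ℝ × ℝ, α ≤ a p.1 p.2) : ∀ᵐ p : ℝ × ℝ, α ≤ a (p.1 / l) (p.2 / l) := by
  filter_upwards [(Measure.quasiMeasurePreserving_smul (volume : Measure (ℝ × ℝ))
    (inv_ne_zero hl)).ae ha] with p hp
  simpa [div_eq_inv_mul] using hp

lemma le_setIntegral_unitSquare {a : ℝ → ℝ → ℝ} (ha : IsHomogenizationKernel a) {α : ℝ}
    (hα : 0 ≤ α) (h : ∀ᵐ p : ℝ × ℝ, α ≤ a p.1 p.2) :
    α ≤ ∫ p in Ioo (0 : ℝ) 1 ×ˢ Ioo (0 : ℝ) 1, a p.1 p.2 := by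
  obtain ⟨β, hβ⟩ := ha.essSup_lt_top
  have hvol : volume (Ioo (0 : ℝ) 1 ×ˢ Ioo (0 : ℝ) 1) = 1 := by
    rw [Measure.volume_eq_prod, Measure.prod_prod]; simp
  have hint : IntegrableOn (fun p : ℝ × ℝ => a p.1 p.2) (Ioo (0 : ℝ) 1 ×ˢ Ioo (0 : ℝ) 1) := by
    refine Measure.integrableOn_of_bounded (M := β) (by simp [hvol])
      ha.aemeasurable.aestronglyMeasurable (ae_restrict_of_ae ?_)
    filter_upwards [h, hβ] with p h1 h2
    rwa [Real.norm_of_nonneg (hα.trans h1)]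
  have := setIntegral_mono_ae (s := Ioo (0 : ℝ) 1 ×ˢ Ioo (0 : ℝ) 1)
    (integrableOn_const (C := α) (by simp [hvol])) hint h
  simpa [measureReal_def, hvol] using this

lemma le_of_ae_le_of_continuous {a : ℝ → ℝ → ℝ} {α : ℝ} (h : ∀ᵐ p : ℝ × ℝ, α ≤ a p.1 p.2)
    (hc : Continuous (fun p : ℝ × ℝ => a p.1 p.2)) (x y : ℝ) : α ≤ a x y := by
  have hcl : IsClosed {p : ℝ × ℝ | α ≤ a p.1 p.2} := isClosed_le continuous_const hc
  have hd : Dense {p : ℝ × ℝ | α ≤ a p.1 p.2} := Measure.dense_of_ae h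
  have : (x, y) ∈ {p : ℝ × ℝ | α ≤ a p.1 p.2} := by
    rw [← hcl.closure_eq]; exact hd (x, y)
  exact this

lemma encard_pos_coe {S : Set ℝ} (h : S.Nonempty) : (0 : ℝ≥0∞) < (S.encard : ℝ≥0∞) := by
  have := encard_pos.2 h
  exact_mod_cast this

theorem proposition5p4 (W : ℝ → ℝ) (hW : IsDoubleWell W) (k : ℕ) (s : ℝ) (hs : s ∈ Ioo (0 : ℝ) 1)
    (hks : 1 / 2 < (k : ℝ) + s) (a : ℝ → ℝ → ℝ) (ha : IsHomogenizationKernel a) :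
    (∀ σ : ℝ, σ = 1 ∨ σ = -1 → 0 < transitionEnergy W k s σ a) ∧
    ∀ u : ℝ → ℝ, IsSignBV u →
      (¬ ∃ c : ℝ, ∀ᵐ x ∂(volume.restrict (Ioo (0 : ℝ) 1)), u x = c) →
      (∀ l : ℝ, 0 < l → 0 < criticalLimitEnergy W k s a l u) ∧
      0 < supercriticalLimitEnergy W k s a u ∧
      (Continuous (fun p : ℝ × ℝ => a p.1 p.2) → 0 < subcriticalLimitEnergy W k s a u) := by
  obtain ⟨α, hα, hαa⟩ := ha.essInf_pos
  refine ⟨fun σ hσ => transitionEnergy_pos hW hs.1 hks hα hαa hσ, fun u hu hc => ?_⟩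
  obtain ⟨t, ht, l', r, hlr, hne⟩ := hu.exists_jump hc
  have hjump : (0 : ℝ≥0∞) < (jumpSet u).encard := encard_pos_coe ⟨t, ht, l', r, hlr, hne⟩
  have hm : 0 < transitionEnergy W k s 1 (fun _ _ => 1) :=
    transitionEnergy_pos hW hs.1 hks one_pos (ae_of_all _ fun _ => le_rfl) (Or.inl rfl)
  refine ⟨fun l hl => ?_, ?_, fun hcont => ?_⟩
  · have hT : ∀ σ : ℝ, σ = 1 ∨ σ = -1 →
        0 < transitionEnergy W k s σ (fun x y => a (x / l) (y / l)) := fun σ hσ =>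
      transitionEnergy_pos hW hs.1 hks hα (ae_le_comp_div hl.ne' hαa) hσ
    rcases lt_or_gt_of_ne hne with h | h
    · have hd : (0 : ℝ≥0∞) < (directedJumpSet 1 u).encard :=
        encard_pos_coe ⟨t, ht, l', r, hlr, Real.sign_of_pos (sub_pos.2 h)⟩
      exact (ENNReal.mul_pos (hT 1 (Or.inl rfl)).ne' hd.ne').trans_le le_self_add
    · have hd : (0 : ℝ≥0∞) < (directedJumpSet (-1) u).encard :=
        encard_pos_coe ⟨t, ht, l', r, hlr, Real.sign_of_neg (sub_neg.2 h)⟩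
      exact (ENNReal.mul_pos (hT (-1) (Or.inr rfl)).ne' hd.ne').trans_le le_add_self
  · have h1 : 0 < ∫ p in Ioo (0 : ℝ) 1 ×ˢ Ioo (0 : ℝ) 1, a p.1 p.2 :=
      hα.trans_le (le_setIntegral_unitSquare ha hα.le hαa)
    exact ENNReal.mul_pos (ENNReal.mul_pos
      (ENNReal.ofReal_pos.2 (Real.rpow_pos_of_pos h1 _)).ne' hm.ne').ne' hjump.ne'
  · have h1 : 0 < sInf ((fun t => a t t) '' Ioo (0 : ℝ) 1) := by
      refine hα.trans_le (le_csInf ((nonempty_Ioo.2 one_pos).image _) ?_)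
      rintro _ ⟨t, -, rfl⟩
      exact le_of_ae_le_of_continuous hαa hcont t t
    exact ENNReal.mul_pos (ENNReal.mul_pos
      (ENNReal.ofReal_pos.2 (Real.rpow_pos_of_pos h1 _)).ne' hm.ne').ne' hjump.ne'
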